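/- Let $c>0$ and let $n\in\{1,2,3\}$. Let $f:\mathbb R^n\times[0,\infty)\to\mathbb R$ be a positive solution of Fisher's equation \[ f_t=\Delta f+c f(1-f), \] of class $C^2$ in $x$ and $C^1$ in $t$, which is a traveling plane wave: $f(x,t)=v(x+\eta t\,\hat a)$ for all $x\in\mathbb R^n$, $t\ge 0$, where $v:\mathbb R^n\to\mathbb R$ is a function, $\hat a\in\mathbb R^n$ with $|\hat a|=1$ is the wave direction and $\eta>0$ is the wave speed. Suppose that there is a nonzero vector $\hat b\in\mathbb R^n$ such that $v(k\hat b)\to 0$ as $k\to\infty$ ($k$ real). Then \[ \eta\ge\begin{cases}\sqrt{(3-\sqrt3)\,c}, & n=1,\\ \sqrt{2c}, & n=2,\\ \sqrt{(7-3\sqrt3)\,c}, & n=3.\end{cases} \] -/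

import Mathlib

open Set Filter Topology

/-- `f : ℝⁿ × [0, ∞) → ℝ` (values at negative times are irrelevant) is a positive solution of
Fisher's equation `f_t = Δ f + c f (1 - f)`, of class `C²` in `x` and `C¹` in `t`. At `t = 0`
the time derivative is the one-sided one. -/
def IsPositiveFisherSolution {n : ℕ} (c : ℝ) (f : EuclideanSpace ℝ (Fin n) → ℝ → ℝ) : Prop :=
  (∀ x t, 0 ≤ t → 0 < f x t) ∧
  (∀ t, 0 ≤ t → ContDiff ℝ 2 (fun x => f x t)) ∧
  (∀ x, ContDiffOn ℝ 1 (fun t => f x t) (Ici 0)) ∧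
  (∀ x t, 0 ≤ t →
    derivWithin (fun s => f x s) (Ici 0) t =
      Laplacian.laplacian (fun y => f y t) x + c * f x t * (1 - f x t))

/-- `f` is a (positive) traveling plane wave solution of Fisher's equation with profile `v`,
wave speed `η > 0` and wave direction `a`, `‖a‖ = 1`: it solves the equation and
`f (x, t) = v (x + η t a)`. -/
structure IsTravelingPlaneWave {n : ℕ} (c : ℝ) (f : EuclideanSpace ℝ (Fin n) → ℝ → ℝ)
    (v : EuclideanSpace ℝ (Fin n) → ℝ) (η : ℝ) (a : EuclideanSpace ℝ (Fin n)) : Prop where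
  solution : IsPositiveFisherSolution c f
  speed_pos : 0 < η
  norm_direction : ‖a‖ = 1
  eq_profile : ∀ x t, 0 ≤ t → f x t = v (x + (η * t) • a)

/-! The classical bound `η ^ 2 ≥ 4 * c` holds in every dimension and implies all three estimates. At
`t = 0` the profile satisfies `η ∂ₐv = Δv + c v (1 - v)`. If `η ^ 2 < 4 * c`, a product of weighted
cosines on a cube is a bump `φ` with `Δφ - η ∂ₐφ = -λ φ` and `λ < c`. Where the least multiple `M v`
dominating `φ` touches it, comparison gives `c (1 - v) ≤ λ`, so `v` is not small there. The cube may
be centred anywhere and `φ` is bounded independently of the centre, so `v` is bounded below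
everywhere (`exists_pos_lower_bound`) and cannot tend to zero along a ray. -/

open Real in
/-- The exponentially weighted cosine `exp (β r / 2) cos (κ r)`. -/
noncomputable def weightedCos (β κ r : ℝ) : ℝ := exp (β / 2 * r) * cos (κ * r)

/-- The derivative of `weightedCos`. -/
noncomputable def weightedCosDeriv (β κ r : ℝ) : ℝ :=
  β / 2 * weightedCos β κ r - κ * (Real.exp (β / 2 * r) * Real.sin (κ * r))

lemma hasDerivAt_weightedCos (β κ r : ℝ) :
    HasDerivAt (weightedCos β κ) (weightedCosDeriv β κ r) r := by
  have h1 : HasDerivAt (fun r : ℝ => β / 2 * r) (β / 2) r := by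
    simpa using (hasDerivAt_id r).const_mul (β / 2)
  have h2 : HasDerivAt (fun r : ℝ => κ * r) κ r := by
    simpa using (hasDerivAt_id r).const_mul κ
  refine (h1.exp.mul h2.cos).congr_deriv ?_
  simp only [weightedCosDeriv, weightedCos]
  ring

lemma hasDerivAt_weightedCosDeriv (β κ r : ℝ) :
    HasDerivAt (weightedCosDeriv β κ)
      (β * weightedCosDeriv β κ r - (κ ^ 2 + β ^ 2 / 4) * weightedCos β κ r) r := by
  have h1 : HasDerivAt (fun r : ℝ => β / 2 * r) (β / 2) r := by
    simpa using (hasDerivAt_id r).const_mul (β / 2)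
  have h2 : HasDerivAt (fun r : ℝ => κ * r) κ r := by
    simpa using (hasDerivAt_id r).const_mul κ
  refine (((hasDerivAt_weightedCos β κ r).const_mul (β / 2)).sub
    ((h1.exp.mul h2.sin).const_mul κ)).congr_deriv ?_
  simp only [weightedCosDeriv, weightedCos]
  ring

/-- If `m < 0`, the second derivative test makes `x` a local maximum too; then `g` is locally
constant and `m = 0`. -/
lemma IsLocalMin.second_deriv_nonneg {g g' : ℝ → ℝ} {x m : ℝ} (hmin : IsLocalMin g x)
    (hg : ∀ t, HasDerivAt g (g' t) t) (hg' : HasDerivAt g' m x) : 0 ≤ m := by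
  by_contra! hm
  have hd : deriv g = g' := funext fun t => (hg t).deriv
  have hmax : IsLocalMax g x := by
    refine isLocalMax_of_deriv_deriv_neg ?_ hmin.deriv_eq_zero (hg x).continuousAt
    rw [hd, hg'.deriv]
    exact hm
  have hconst : g =ᶠ[𝓝 x] fun _ => g x := by
    filter_upwards [hmin, hmax] with t h1 h2 using le_antisymm h2 h1
  have hzero : g' =ᶠ[𝓝 x] fun _ => 0 := by
    have := hconst.deriv
    rw [hd] at this
    simpa using this
  have := hzero.deriv_eq
  rw [hg'.deriv, deriv_const] at this
  exact hm.ne this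

/-- A function touching a multiple of a weighted cosine from above satisfies the corresponding
second-order differential inequality at the contact point. -/
lemma weightedCos_le_of_isLocalMin {u u' : ℝ → ℝ} {u'' M C β κ r : ℝ}
    (hu : ∀ t, HasDerivAt u (u' t) t) (hu' : HasDerivAt u' u'' 0)
    (hmin : IsLocalMin (fun t => M * u t - C * weightedCos β κ (r + t)) 0) :
    -(κ ^ 2 + β ^ 2 / 4) * (C * weightedCos β κ r) ≤ M * (u'' - β * u' 0) := by
  have hg : ∀ t, HasDerivAt (fun t => M * u t - C * weightedCos β κ (r + t))
      (M * u' t - C * weightedCosDeriv β κ (r + t)) t := fun t =>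
    ((hu t).const_mul M).sub
      (((hasDerivAt_weightedCos β κ (r + t)).comp_const_add r t).const_mul C)
  have hW := hasDerivAt_weightedCosDeriv β κ (r + 0)
  have hg' := (hu'.const_mul M).sub ((hW.comp_const_add r 0).const_mul C)
  have h2 := hmin.second_deriv_nonneg hg hg'
  have h1 := hmin.hasDerivAt_eq_zero (hg 0)
  simp only [add_zero] at h1 h2
  -- The first-order condition `h1` trades the drift term of the cosine for that of `u`.
  linear_combination h2 + β * h1

section Cube

variable {n : ℕ}

/-- The product of the weighted cosines in all coordinates, centred at `y`. -/
noncomputable def cubeBump (η κ : ℝ) (a y x : EuclideanSpace ℝ (Fin n)) : ℝ :=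
  ∏ i, weightedCos (η * a i) κ (x i - y i)

/-- The closed cube centred at `y` on which the factors of `cubeBump` are nonnegative. -/
def cosCube (κ : ℝ) (y : EuclideanSpace ℝ (Fin n)) : Set (EuclideanSpace ℝ (Fin n)) :=
  {x | ∀ i, |κ * (x i - y i)| ≤ Real.pi / 2}

lemma isCompact_cosCube {κ : ℝ} (hκ : 0 < κ) (y : EuclideanSpace ℝ (Fin n)) :
    IsCompact (cosCube κ y) := by
  have hK : IsCompact (Set.pi univ fun i => Icc (y i - Real.pi / 2 / κ) (y i + Real.pi / 2 / κ)) :=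
    isCompact_univ_pi fun i => isCompact_Icc
  convert (EuclideanSpace.equiv (Fin n) ℝ).symm.toHomeomorph.isCompact_image.2 hK using 1
  ext x
  simp only [cosCube, Set.mem_ofPred_eq, mem_image, mem_univ_pi]
  have key : ∀ s : ℝ, ∀ i, |κ * (s - y i)| ≤ Real.pi / 2 ↔
      s ∈ Icc (y i - Real.pi / 2 / κ) (y i + Real.pi / 2 / κ) := by
    intro s i
    rw [abs_mul, abs_of_pos hκ, mul_comm, ← le_div_iff₀ hκ, abs_le, mem_Icc]
    constructor <;> rintro ⟨h1, h2⟩ <;> constructor <;> linarith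
  constructor
  · intro h
    exact ⟨fun i => x i, fun i => (key _ i).1 (h i), rfl⟩
  · rintro ⟨z, hz, rfl⟩ i
    exact (key _ i).2 (hz i)

lemma weightedCos_nonneg {β κ r : ℝ} (h : |κ * r| ≤ Real.pi / 2) : 0 ≤ weightedCos β κ r :=
  mul_nonneg (Real.exp_pos _).le (Real.cos_nonneg_of_mem_Icc (abs_le.1 h))

lemma weightedCos_le {η α κ r : ℝ} (hη : 0 < η) (hκ : 0 < κ) (hα : |α| ≤ 1)
    (h : |κ * r| ≤ Real.pi / 2) :
    weightedCos (η * α) κ r ≤ Real.exp (η / 2 * (Real.pi / 2 / κ)) := by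
  have hr : |r| ≤ Real.pi / 2 / κ := by
    rw [le_div_iff₀ hκ, mul_comm]
    rwa [abs_mul, abs_of_pos hκ] at h
  have hαr : α * r ≤ Real.pi / 2 / κ :=
    calc α * r ≤ |α| * |r| := (le_abs_self _).trans (abs_mul _ _).le
      _ ≤ 1 * |r| := by gcongr
      _ ≤ _ := by simpa using hr
  calc weightedCos (η * α) κ r ≤ Real.exp (η * α / 2 * r) * 1 := by
        unfold weightedCos
        gcongr
        exact Real.cos_le_one _
    _ = Real.exp (η / 2 * (α * r)) := by ring_nf
    _ ≤ _ := by gcongr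

lemma cubeBump_le {η κ : ℝ} (hη : 0 < η) (hκ : 0 < κ) {a : EuclideanSpace ℝ (Fin n)}
    (ha : ‖a‖ = 1) {x y : EuclideanSpace ℝ (Fin n)} (hx : x ∈ cosCube κ y) :
    cubeBump η κ a y x ≤ Real.exp (η / 2 * (Real.pi / 2 / κ)) ^ n := by
  have := Finset.prod_le_prod (s := Finset.univ)
    (fun i _ => weightedCos_nonneg (β := η * a i) (hx i))
    (fun i _ => weightedCos_le hη hκ (ha ▸ PiLp.norm_apply_le a i) (hx i))
  simpa [cubeBump] using this

lemma continuous_cubeBump (η κ : ℝ) (a y : EuclideanSpace ℝ (Fin n)) :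
    Continuous (cubeBump η κ a y) := by
  unfold cubeBump weightedCos
  fun_prop

lemma cubeBump_self (η κ : ℝ) (a y : EuclideanSpace ℝ (Fin n)) : cubeBump η κ a y y = 1 := by
  simp [cubeBump, weightedCos]

lemma cubeBump_add_single (η κ : ℝ) (a y x : EuclideanSpace ℝ (Fin n)) (i : Fin n) (t : ℝ) :
    cubeBump η κ a y (x + t • EuclideanSpace.single i 1) =
      (∏ j ∈ Finset.univ.erase i, weightedCos (η * a j) κ (x j - y j)) *
        weightedCos (η * a i) κ (x i - y i + t) := by
  rw [cubeBump, ← Finset.prod_erase_mul _ _ (Finset.mem_univ i)]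
  congr 1
  · refine Finset.prod_congr rfl fun j hj => ?_
    have hji : j ≠ i := Finset.ne_of_mem_erase hj
    simp [hji]
  · simp only [PiLp.add_apply, PiLp.smul_apply, PiLp.single_apply, if_true, smul_eq_mul,
      mul_one]
    ring_nf

/-- Some cosine vanishes on each face, so a maximum over the cube with positive bump is interior. -/
lemma abs_lt_of_cubeBump_pos {η κ : ℝ} {a y x : EuclideanSpace ℝ (Fin n)} (hx : x ∈ cosCube κ y)
    (hpos : 0 < cubeBump η κ a y x) (i : Fin n) : |κ * (x i - y i)| < Real.pi / 2 := by
  refine lt_of_le_of_ne (hx i) fun h => hpos.ne' ?_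
  refine Finset.prod_eq_zero (Finset.mem_univ i) ?_
  rw [weightedCos, ← Real.cos_abs, h, Real.cos_pi_div_two, mul_zero]

lemma eventually_mem_cosCube {κ : ℝ} {y x : EuclideanSpace ℝ (Fin n)}
    (hx : ∀ i, |κ * (x i - y i)| < Real.pi / 2) : ∀ᶠ z in 𝓝 x, z ∈ cosCube κ y := by
  refine eventually_all.2 fun i => ?_
  have hc : Continuous fun z : EuclideanSpace ℝ (Fin n) => |κ * (z i - y i)| := by fun_prop
  exact (hc.continuousAt.eventually_lt continuousAt_const (hx i)).mono fun z hz => hz.le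

lemma laplacian_eq_sum_single (v : EuclideanSpace ℝ (Fin n) → ℝ) (x : EuclideanSpace ℝ (Fin n)) :
    Laplacian.laplacian v x = ∑ i, fderiv ℝ (fderiv ℝ v) x (EuclideanSpace.single i 1)
      (EuclideanSpace.single i 1) := by
  rw [InnerProductSpace.laplacian_eq_iteratedFDeriv_orthonormalBasis v
    (EuclideanSpace.basisFun (Fin n) ℝ)]
  simp [iteratedFDeriv_two_apply]

lemma fderiv_eq_sum_single (L : EuclideanSpace ℝ (Fin n) →L[ℝ] ℝ) (a : EuclideanSpace ℝ (Fin n)) :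
    L a = ∑ i, a i * L (EuclideanSpace.single i 1) := by
  conv_lhs => rw [← (EuclideanSpace.basisFun (Fin n) ℝ).sum_repr a]
  simp

lemma sum_sq_eq_one {a : EuclideanSpace ℝ (Fin n)} (ha : ‖a‖ = 1) : ∑ i, a i ^ 2 = 1 := by
  rw [← EuclideanSpace.real_norm_sq_eq, ha, one_pow]

lemma hasDerivAt_line {F : Type*} [NormedAddCommGroup F] [NormedSpace ℝ F]
    {v : EuclideanSpace ℝ (Fin n) → F} (hv : Differentiable ℝ v)
    (x e : EuclideanSpace ℝ (Fin n)) (t : ℝ) :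
    HasDerivAt (fun t : ℝ => v (x + t • e)) (fderiv ℝ v (x + t • e) e) t := by
  have h : HasDerivAt (fun t : ℝ => x + t • e) e t := by
    simpa using ((hasDerivAt_id t).smul_const e).const_add x
  exact (hv (x + t • e)).hasFDerivAt.comp_hasDerivAt t h

/-- If `M v` touches `cubeBump` from above at `x`, then the drift Laplacian of `M v` at `x` is
bounded below by that of `cubeBump`. -/
lemma drift_laplacian_ge {v : EuclideanSpace ℝ (Fin n) → ℝ} (hv : ContDiff ℝ 2 v) {M η κ : ℝ}
    {a y x : EuclideanSpace ℝ (Fin n)} (ha : ‖a‖ = 1)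
    (hmin : IsLocalMin (fun z => M * v z - cubeBump η κ a y z) x) :
    -(n * κ ^ 2 + η ^ 2 / 4) * cubeBump η κ a y x ≤
      M * (Laplacian.laplacian v x - η * fderiv ℝ v x a) := by
  have hd : Differentiable ℝ v := hv.differentiable (by norm_num)
  have hd' : Differentiable ℝ (fderiv ℝ v) :=
    (hv.fderiv_right (m := 1) (by norm_num)).differentiable (by norm_num)
  have key : ∀ i, -(κ ^ 2 + (η * a i) ^ 2 / 4) * cubeBump η κ a y x ≤
      M * (fderiv ℝ (fderiv ℝ v) x (EuclideanSpace.single i 1) (EuclideanSpace.single i 1)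
        - η * a i * fderiv ℝ v x (EuclideanSpace.single i 1)) := by
    intro i
    set e : EuclideanSpace ℝ (Fin n) := EuclideanSpace.single i 1 with he
    have hline := hasDerivAt_line hd x e
    have hline' : HasDerivAt (fun t : ℝ => fderiv ℝ v (x + t • e) e)
        (fderiv ℝ (fderiv ℝ v) x e e) 0 := by
      have := (hasDerivAt_line hd' x e 0).clm_apply (hasDerivAt_const 0 e)
      simpa using this
    have hx0 : x + (0 : ℝ) • e = x := by simp
    have hcont : ContinuousAt (fun t : ℝ => x + t • e) 0 := by fun_prop
    have hmin' : IsLocalMin (fun t : ℝ => M * v (x + t • e) - cubeBump η κ a y (x + t • e)) 0 := by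
      have h := hcont.tendsto
      rw [hx0] at h
      have := h.eventually hmin
      unfold IsLocalMin IsMinFilter
      simpa only [hx0] using this
    simp only [he, cubeBump_add_single] at hmin'
    have := weightedCos_le_of_isLocalMin hline hline' hmin'
    have hC := cubeBump_add_single η κ a y x i 0
    rw [← he, hx0, add_zero] at hC
    rw [← hC, hx0] at this
    exact this
  have hsum := Finset.sum_le_sum fun i (_ : i ∈ Finset.univ) => key i
  rw [← Finset.sum_mul, ← Finset.mul_sum, Finset.sum_sub_distrib, ← laplacian_eq_sum_single] at hsum
  have e1 : ∑ i, -(κ ^ 2 + (η * a i) ^ 2 / 4) = -(n * κ ^ 2 + η ^ 2 / 4) := by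
    simp only [mul_pow, mul_div_right_comm, Finset.sum_neg_distrib, Finset.sum_add_distrib,
      ← Finset.mul_sum, sum_sq_eq_one ha]
    simp
  have e2 : ∑ i, η * a i * fderiv ℝ v x (EuclideanSpace.single i 1) = η * fderiv ℝ v x a := by
    rw [fderiv_eq_sum_single _ a, Finset.mul_sum]
    exact Finset.sum_congr rfl fun i _ => mul_assoc _ _ _
  rwa [e1, e2] at hsum

/-- Below the critical speed, positive entire solutions of the elliptic traveling wave equation are
bounded away from zero. -/
lemma exists_pos_lower_bound {v : EuclideanSpace ℝ (Fin n) → ℝ} (hv : ContDiff ℝ 2 v)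
    (hpos : ∀ x, 0 < v x) {c η : ℝ} (hc : 0 < c) (hη : 0 < η) {a : EuclideanSpace ℝ (Fin n)}
    (ha : ‖a‖ = 1)
    (heq : ∀ x, η * fderiv ℝ v x a = Laplacian.laplacian v x + c * v x * (1 - v x))
    (hlt : η ^ 2 < 4 * c) : ∃ ε > 0, ∀ y, ε ≤ v y := by
  -- Dividing by `n + 1` leaves exactly `q` of the gap after `n * κ ^ 2` is spent.
  set q : ℝ := (c - η ^ 2 / 4) / (n + 1) with hq
  have hqpos : 0 < q := by
    have : 0 < c - η ^ 2 / 4 := by linarith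
    positivity
  set κ : ℝ := Real.sqrt q with hκdef
  have hκ : 0 < κ := Real.sqrt_pos.2 hqpos
  have hκsq : κ ^ 2 = q := Real.sq_sqrt hqpos.le
  have hgap : c - (n * κ ^ 2 + η ^ 2 / 4) = q := by
    rw [hκsq, hq]
    field_simp
    ring
  set B : ℝ := Real.exp (η / 2 * (Real.pi / 2 / κ)) ^ n with hB
  have hBpos : 0 < B := by positivity
  refine ⟨q / c / B, by positivity, fun y => ?_⟩
  have hy : y ∈ cosCube κ y := fun i => by simpa using Real.pi_div_two_pos.le
  -- The maximal ratio is the least `M` with `M * v` above the bump on the cube.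
  obtain ⟨x, hx, hmax⟩ := (isCompact_cosCube hκ y).exists_isMaxOn ⟨y, hy⟩
    (f := fun x => cubeBump η κ a y x / v x)
    ((continuous_cubeBump η κ a y).div hv.continuous fun x => (hpos x).ne').continuousOn
  set M : ℝ := cubeBump η κ a y x / v x with hM
  have hMy : 1 / v y ≤ M := by
    have := hmax hy
    simpa [cubeBump_self] using this
  have hMpos : 0 < M := (one_div_pos.2 (hpos y)).trans_le hMy
  have hMx : M * v x = cubeBump η κ a y x := div_mul_cancel₀ _ (hpos x).ne'
  have hbump : 0 < cubeBump η κ a y x := hMx ▸ mul_pos hMpos (hpos x)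
  have hmin : IsLocalMin (fun z => M * v z - cubeBump η κ a y z) x := by
    filter_upwards [eventually_mem_cosCube (abs_lt_of_cubeBump_pos hx hbump)] with z hz
    have : cubeBump η κ a y z / v z ≤ M := hmax hz
    rw [div_le_iff₀ (hpos z)] at this
    linarith
  have hdrift := drift_laplacian_ge hv ha hmin
  have hvx : q / c ≤ v x := by
    rw [heq x, ← hMx] at hdrift
    have h : 0 ≤ (M * v x) * (c * v x - q) := by
      rw [← hgap]
      linear_combination hdrift
    have := nonneg_of_mul_nonneg_right h (mul_pos hMpos (hpos x))
    rw [div_le_iff₀ hc]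
    linarith
  calc q / c / B ≤ v x / cubeBump η κ a y x := by
        exact div_le_div₀ (hpos x).le hvx hbump (cubeBump_le hη hκ ha hx)
    _ = 1 / M := by rw [hM, one_div_div]
    _ ≤ v y := (one_div_le hMpos (hpos y)).2 hMy

/-- The profile of a traveling plane wave is a positive `C²` solution of the elliptic traveling wave
equation. -/
lemma IsTravelingPlaneWave.profile_eq {c η : ℝ} {f : EuclideanSpace ℝ (Fin n) → ℝ → ℝ}
    {v : EuclideanSpace ℝ (Fin n) → ℝ} {a : EuclideanSpace ℝ (Fin n)}
    (hf : IsTravelingPlaneWave c f v η a) :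
    (∀ x, 0 < v x) ∧ ContDiff ℝ 2 v ∧
      ∀ x, η * fderiv ℝ v x a = Laplacian.laplacian v x + c * v x * (1 - v x) := by
  obtain ⟨hpos, hcd, -, hpde⟩ := hf.solution
  have h0 : (fun x => f x 0) = v := funext fun x => by simpa using hf.eq_profile x 0 le_rfl
  have hv : ContDiff ℝ 2 v := h0 ▸ hcd 0 le_rfl
  refine ⟨fun x => ?_, hv, fun x => ?_⟩
  · have := hpos x 0 le_rfl
    rwa [congrFun h0 x] at this
  · have h := hpde x 0 le_rfl
    rw [h0, congrFun h0 x] at h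
    rw [← h]
    have hline := hasDerivAt_line (hv.differentiable (by norm_num)) x (η • a) 0
    have hw : HasDerivWithinAt (fun s => f x s) (fderiv ℝ v (x + (0 : ℝ) • η • a) (η • a))
        (Ici 0) 0 := by
      refine hline.hasDerivWithinAt.congr (fun s hs => ?_) ?_
      · rw [hf.eq_profile x s hs, smul_smul, mul_comm]
      · rw [hf.eq_profile x 0 le_rfl, smul_smul, mul_comm]
    rw [hw.derivWithin (uniqueDiffOn_Ici 0 0 self_mem_Ici)]
    simp

/-- A traveling plane wave whose profile tends to zero along some ray has at least the critical
speed. -/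
lemma IsTravelingPlaneWave.four_mul_le_sq {c η : ℝ} (hc : 0 < c)
    {f : EuclideanSpace ℝ (Fin n) → ℝ → ℝ} {v : EuclideanSpace ℝ (Fin n) → ℝ}
    {a b : EuclideanSpace ℝ (Fin n)} (hf : IsTravelingPlaneWave c f v η a)
    (hb : Tendsto (fun k : ℝ => v (k • b)) atTop (𝓝 0)) : 4 * c ≤ η ^ 2 := by
  by_contra! hlt
  obtain ⟨hpos, hv, heq⟩ := hf.profile_eq
  obtain ⟨ε, hε, hle⟩ :=
    exists_pos_lower_bound hv hpos hc hf.speed_pos hf.norm_direction heq hlt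
  exact hε.not_ge (ge_of_tendsto' hb fun k => hle _)

end Cube

theorem theorem3 (n : ℕ) (c : ℝ) (hc : 0 < c)
    (f : EuclideanSpace ℝ (Fin n) → ℝ → ℝ) (v : EuclideanSpace ℝ (Fin n) → ℝ)
    (η : ℝ) (a : EuclideanSpace ℝ (Fin n))
    (hf : IsTravelingPlaneWave c f v η a)
    (hv : ∃ b : EuclideanSpace ℝ (Fin n), b ≠ 0 ∧
      Tendsto (fun k : ℝ => v (k • b)) atTop (𝓝 0)) :
    (n = 1 → Real.sqrt ((3 - Real.sqrt 3) * c) ≤ η) ∧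
    (n = 2 → Real.sqrt (2 * c) ≤ η) ∧
    (n = 3 → Real.sqrt ((7 - 3 * Real.sqrt 3) * c) ≤ η) := by
  obtain ⟨b, -, hb⟩ := hv
  have h4 := hf.four_mul_le_sq hc hb
  -- This gives `3 - √3 ≤ 2` and `7 - 3√3 ≤ 4`, so `4 * c ≤ η ^ 2` suffices in each case.
  have h3 : 1 ≤ Real.sqrt 3 := Real.one_le_sqrt.2 (by norm_num)
  refine ⟨fun _ => ?_, fun _ => ?_, fun _ => ?_⟩ <;>
    refine Real.sqrt_le_iff.2 ⟨hf.speed_pos.le, ?_⟩ <;>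
    nlinarith
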